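/- Let $d\geq 4$ be an integer, let $0\leq t<\sqrt{d}/2$, and put $z=\frac{d}{2}-t\sqrt{d}$. For a unit vector $a\in\mathbb{R}^d$, let $$H_a=\Bigl\{x\in\mathbb{R}^d : a\cdot x=\tfrac12\sum_{j=1}^d a_j-t\Bigr\},$$ so that the sets $H_a$ are exactly the hyperplanes at distance $t$ from the center of the hypercube $[0,1]^d$, and let $V(a)$ be the $(d-1)$-dimensional volume of $H_a\cap[0,1]^d$. A diagonal of $[0,1]^d$ is a segment between two opposite vertices. For $0\le i\le d$ let $$p_{i,d}(z)=\frac{i(d-i)}{d-1}-\Bigl(\frac d2-i\Bigr)\frac{z-i}{d-2}+\frac{2d(z-i)^2}{(d-1)(d-2)},$$ and let $$S=\sum_{i=0}^{\lfloor z\rfloor}(-1)^i\binom{d}{i}(z-i)^{d-3}p_{i,d}(z).$$ If $S<0$, then $V$, as a function on the unit sphere $\mathbb{S}^{d-1}$, has a strict local maximum at every $a\in\mathbb{S}^{d-1}$ such that $H_a$ is orthogonal to a diagonal of $[0,1]^d$. If $S>0$, then $V$ has a strict local minimum on $\mathbb{S}^{d-1}$ at every such $a$. -/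

import Mathlib

open MeasureTheory Topology
open scoped InnerProductSpace

/-- The hypercube `[0,1]^d` in Euclidean space. -/
def hypercube (d : ℕ) : Set (EuclideanSpace ℝ (Fin d)) :=
  {x | ∀ i, 0 ≤ x i ∧ x i ≤ 1}

/-- The hyperplane `a · x = b` with `b = σ(a) / 2 - t`, where `σ(a)` is the sum of the coordinates
of `a`. When `‖a‖ = 1` and `0 ≤ t`, it is at distance `t` from the center of the hypercube, and
every hyperplane at distance `t` from that center is of this form for some unit vector `a`. -/
def hyperplaneAt {d : ℕ} (t : ℝ) (a : EuclideanSpace ℝ (Fin d)) :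
    Set (EuclideanSpace ℝ (Fin d)) :=
  {x | ⟪a, x⟫_ℝ = (∑ i, a i) / 2 - t}

/-- The `(d-1)`-dimensional volume of `H ∩ [0,1]^d`, where `H` is the hyperplane above. -/
noncomputable def sectionVolume {d : ℕ} (t : ℝ) (a : EuclideanSpace ℝ (Fin d)) : ENNReal :=
  μHE[d - 1] (hyperplaneAt t a ∩ hypercube d)

/-- `H` is orthogonal to a diagonal of the hypercube, that is, to the segment between
two opposite vertices `v` and `w`. -/
def IsOrthogonalToDiagonal {d : ℕ} (H : Set (EuclideanSpace ℝ (Fin d))) : Prop :=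
  ∃ v w : EuclideanSpace ℝ (Fin d), (∀ i, v i = 0 ∨ v i = 1) ∧ (∀ i, w i = 1 - v i) ∧
    ∀ x ∈ H, ∀ y ∈ H, ⟪x - y, w - v⟫_ℝ = 0

/-- `f` has a strict local maximum at the point `a` of `s`, relative to `s`. -/
def IsStrictLocalMaxOn {X β : Type*} [TopologicalSpace X] [Preorder β]
    (f : X → β) (s : Set X) (a : X) : Prop :=
  ∀ᶠ x in 𝓝[s \ {a}] a, f x < f a

/-- `f` has a strict local minimum at the point `a` of `s`, relative to `s`. -/
def IsStrictLocalMinOn {X β : Type*} [TopologicalSpace X] [Preorder β]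
    (f : X → β) (s : Set X) (a : X) : Prop :=
  ∀ᶠ x in 𝓝[s \ {a}] a, f a < f x

/-- The quadratic function `p_{i,d}` of `z`. -/
noncomputable def quadP (i d : ℕ) (z : ℝ) : ℝ :=
  (i : ℝ) * ((d : ℝ) - i) / ((d : ℝ) - 1) - ((d : ℝ) / 2 - i) * ((z - i) / ((d : ℝ) - 2))
    + 2 * (d : ℝ) * (z - i) ^ 2 / (((d : ℝ) - 1) * ((d : ℝ) - 2))

/-- The sum `∑_{i=0}^{⌊z⌋} (-1)^i C(d,i) (z-i)^{d-3} p_{i,d}(z)`, for `z ≥ 0` and `d ≥ 3`. -/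
noncomputable def diagonalSum (d : ℕ) (z : ℝ) : ℝ :=
  ∑ i ∈ Finset.range (⌊z⌋₊ + 1),
    (-1 : ℝ) ^ i * (d.choose i : ℝ) * (z - i) ^ (d - 3) * quadP i d z

/-!
For a unit normal `a` with positive coordinates the section has an explicit volume,

  `V(a) = 1 / ((d-1)! ∏ aᵢ) * ∑_T (-1)^|T| (σ(a)/2 - t - ∑_{i ∈ T} aᵢ)₊^(d-1)`,

the sum being over all subsets `T` of the coordinates (`sectionVolume_eq_vertexSum`). It comes from
projecting the section along a coordinate axis, which multiplies volumes by the corresponding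
coordinate of `a` (the Gram determinant in `normDet_graphMap_sq`), and from computing the volume
of the part of a cube in a half-space by induction on the dimension (`volume_cubeHalfSpace`).

If the section is orthogonal to a diagonal, all coordinates of `a` have absolute value `1/√d`, and
reflections of the cube reduce the claim to `a = (1/√d, …, 1/√d)`. A nearby unit vector is
`(1 + u) / ‖1 + u‖` with `∑ uᵢ = 0`, and then, with `q = ∑ uᵢ²` and `‖1 + u‖ = √(d + q)`,

  `(d-1)! V = √(d + q) / ∏ (1 + uᵢ) * ∑_T (-1)^|T| (d/2 - t √(d + q) - |T| - ∑_{i ∈ T} uᵢ)₊^(d-1)`.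

As `d ≥ 4`, the truncated power is twice continuously differentiable, so that everything can be
expanded up to `o(q)`. Under the permutation symmetry of the cube the terms linear in `u` cancel and
the quadratic ones become a multiple of `q` (`sum_weight_mul_sum_sq_eq`). The coefficient of `q` in
the result is a positive multiple of the sum `diagonalSum d z` (`expansion_normalizedVolume`), whose
sign therefore decides between a strict local maximum and a strict local minimum.
-/

/-! ### The volume of a cube cut by a half-space -/

/-- The truncated power `x₊ᵐ`. The case `m = 0` is the indicator function of `[0, ∞)`, which is
why this is not encoded as `max x 0 ^ m`. -/
noncomputable def truncPow (m : ℕ) (x : ℝ) : ℝ := if 0 ≤ x then x ^ m else 0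

/-- The alternating sum `∑ (-1)^{|T|} (s - ∑_{i ∈ T} a i)₊ᵐ` over the subsets `T` of `ι`, that is,
over the vertices of the cube `[0,1]^ι`. -/
noncomputable def vertexSum {ι : Type*} [Fintype ι] (m : ℕ) (a : ι → ℝ) (s : ℝ) : ℝ :=
  ∑ T : Finset ι, (-1 : ℝ) ^ T.card * truncPow m (s - ∑ i ∈ T, a i)

theorem truncPow_of_nonneg {m : ℕ} {x : ℝ} (hx : 0 ≤ x) : truncPow m x = x ^ m := if_pos hx

theorem truncPow_of_neg {m : ℕ} {x : ℝ} (hx : x < 0) : truncPow m x = 0 := if_neg hx.not_ge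

theorem truncPow_succ (m : ℕ) (x : ℝ) : truncPow (m + 1) x = max x 0 ^ (m + 1) := by
  rcases le_or_gt 0 x with h | h
  · rw [truncPow_of_nonneg h, max_eq_left h]
  · rw [truncPow_of_neg h, max_eq_right h.le, zero_pow (Nat.succ_ne_zero m)]

theorem continuous_truncPow_succ (m : ℕ) : Continuous (truncPow (m + 1)) := by
  rw [show truncPow (m + 1) = fun x => max x 0 ^ (m + 1) from funext (truncPow_succ m)]
  fun_prop

theorem monotone_truncPow (m : ℕ) : Monotone (truncPow m) := by
  intro x y hxy
  rcases le_or_gt 0 x with h | h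
  · rw [truncPow_of_nonneg h, truncPow_of_nonneg (h.trans hxy)]
    exact pow_le_pow_left₀ h hxy m
  · rw [truncPow_of_neg h]
    unfold truncPow
    split_ifs with hy
    · positivity
    · exact le_rfl

theorem hasDerivAt_truncPow_succ (m : ℕ) {x : ℝ} (hx : x ≠ 0) :
    HasDerivAt (truncPow (m + 1)) ((m + 1) * truncPow m x) x := by
  rcases hx.lt_or_gt with h | h
  · rw [truncPow_of_neg h, mul_zero]
    refine (hasDerivAt_const x (0 : ℝ)).congr_of_eventuallyEq ?_
    filter_upwards [Iio_mem_nhds h] with y hy using truncPow_of_neg hy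
  · rw [truncPow_of_nonneg h.le]
    have := hasDerivAt_pow (m + 1) x
    push_cast at this
    refine this.congr_of_eventuallyEq ?_
    filter_upwards [Ioi_mem_nhds h] with y hy using truncPow_of_nonneg hy.le

theorem intervalIntegrable_truncPow_affine (m : ℕ) {c : ℝ} (hc : 0 < c) (s : ℝ) :
    IntervalIntegrable (fun x => truncPow m (s - c * x)) volume 0 1 := by
  apply Antitone.intervalIntegrable
  intro x y hxy
  exact monotone_truncPow m (by nlinarith)

/-- The antiderivative fails to be differentiable only where the argument vanishes (this happens for
`m = 0`), so the fundamental theorem of calculus off a countable set applies. -/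
theorem integral_truncPow_affine (m : ℕ) {c : ℝ} (hc : 0 < c) (s : ℝ) :
    ∫ x in (0 : ℝ)..1, truncPow m (s - c * x)
      = (truncPow (m + 1) s - truncPow (m + 1) (s - c)) / (c * (m + 1)) := by
  have hm : (m : ℝ) + 1 ≠ 0 := by positivity
  have key := integral_eq_of_hasDerivAt_off_countable
    (fun x => - truncPow (m + 1) (s - c * x) / (c * (m + 1)))
    (fun x => truncPow m (s - c * x)) (a := 0) (b := 1) (s := {s / c}) (Set.countable_singleton _)
    (by
      have := continuous_truncPow_succ m
      fun_prop)
    (by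
      rintro x ⟨-, hx⟩
      have hx0 : s - c * x ≠ 0 := by
        intro h
        apply hx
        rw [Set.mem_singleton_iff, eq_div_iff hc.ne']
        linarith
      have h1 : HasDerivAt (fun x => s - c * x) (-c) x := by
        simpa using ((hasDerivAt_id x).const_mul c).const_sub s
      have h2 := (((hasDerivAt_truncPow_succ m hx0).comp x h1).neg).div_const (c * (m + 1))
      convert! h2 using 1
      field_simp)
    (intervalIntegrable_truncPow_affine m hc s)
  rw [key]
  simp only [mul_one, mul_zero, sub_zero]
  ring

/-- Splitting the subsets of `Fin (n + 1)` according to whether they contain `0`. -/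
theorem sum_finset_fin_succ {M : Type*} [AddCommMonoid M] (n : ℕ) (F : Finset (Fin (n + 1)) → M) :
    ∑ T, F T = ∑ T : Finset (Fin n),
      (F (T.map (Fin.succEmb n)) + F (insert 0 (T.map (Fin.succEmb n)))) := by
  have h0 : (0 : Fin (n + 1)) ∉ Finset.univ.map (Fin.succEmb n) := by simp
  have hp (G : Finset (Fin (n + 1)) → M) : ∑ T ∈ (Finset.univ.map (Fin.succEmb n)).powerset, G T
      = ∑ T : Finset (Fin n), G (T.map (Fin.succEmb n)) := by
    symm
    refine Finset.sum_nbij (fun T => T.map (Fin.succEmb n)) ?_ ?_ ?_ (fun _ _ => rfl)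
    · intro T _
      simp
    · intro T _ T' _ h
      exact Finset.map_injective _ h
    · intro T hT
      obtain ⟨u, -, rfl⟩ := Finset.subset_map_iff.1 (Finset.mem_powerset.1 hT)
      exact ⟨u, by simp, rfl⟩
  rw [Finset.sum_add_distrib, ← hp F, ← hp (fun T => F (insert 0 T)),
    ← Finset.sum_powerset_insert h0 F, ← Finset.powerset_univ]
  congr 2
  ext i
  refine Fin.cases ?_ (fun j => ?_) i <;> simp

theorem vertexSum_fin_succ {n : ℕ} (m : ℕ) (a : Fin (n + 1) → ℝ) (s : ℝ) :
    vertexSum m a s = vertexSum m (fun i : Fin n => a i.succ) s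
      - vertexSum m (fun i : Fin n => a i.succ) (s - a 0) := by
  unfold vertexSum
  rw [sum_finset_fin_succ, ← Finset.sum_sub_distrib]
  refine Finset.sum_congr rfl fun T _ => ?_
  have h0 : (0 : Fin (n + 1)) ∉ T.map (Fin.succEmb n) := by simp
  rw [Finset.card_insert_of_notMem h0, Finset.sum_insert h0, Finset.card_map, Finset.sum_map,
    pow_succ, ← sub_sub]
  simp only [Fin.coe_succEmb]
  ring

theorem integral_vertexSum_affine {ι : Type*} [Fintype ι] (m : ℕ) (a : ι → ℝ) {c : ℝ} (hc : 0 < c)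
    (s : ℝ) : ∫ x in (0 : ℝ)..1, vertexSum m a (s - c * x)
      = (vertexSum (m + 1) a s - vertexSum (m + 1) a (s - c)) / (c * (m + 1)) := by
  unfold vertexSum
  have h (x : ℝ) (T : Finset ι) : s - c * x - ∑ i ∈ T, a i = (s - ∑ i ∈ T, a i) - c * x := by ring
  simp_rw [h]
  rw [intervalIntegral.integral_finsetSum fun T _ =>
    (intervalIntegrable_truncPow_affine m hc _).const_mul _]
  simp_rw [intervalIntegral.integral_const_mul, integral_truncPow_affine m hc]
  rw [← Finset.sum_sub_distrib, Finset.sum_div]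
  refine Finset.sum_congr rfl fun T _ => ?_
  rw [show s - c - ∑ i ∈ T, a i = s - ∑ i ∈ T, a i - c by ring]
  ring

/-- The part of the cube `[0,1]^ι` in the half-space `∑ i, a i * x i ≤ s`. -/
def cubeHalfSpace {ι : Type*} [Fintype ι] (a : ι → ℝ) (s : ℝ) : Set (ι → ℝ) :=
  {x | (∀ i, 0 ≤ x i ∧ x i ≤ 1) ∧ ∑ i, a i * x i ≤ s}

theorem measurableSet_cubeHalfSpace {ι : Type*} [Fintype ι] (a : ι → ℝ) (s : ℝ) :
    MeasurableSet (cubeHalfSpace a s) := by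
  unfold cubeHalfSpace
  measurability

/-- By Fubini, slicing along the first coordinate turns the formula in dimension `n` into the one in
dimension `n + 1`. The nonnegativity is kept in the induction because `ENNReal.ofReal` truncates. -/
theorem volume_cubeHalfSpace : ∀ {n : ℕ} (a : Fin n → ℝ), (∀ i, 0 < a i) → ∀ s : ℝ,
    0 ≤ vertexSum n a s ∧
    volume (cubeHalfSpace a s) = ENNReal.ofReal (vertexSum n a s / (n.factorial * ∏ i, a i)) := by
  intro n
  induction n with
  | zero =>
    intro a _ s
    have hv : vertexSum 0 a s = if 0 ≤ s then 1 else 0 := by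
      simp [vertexSum, truncPow, show (default : Finset (Fin 0)) = ∅ from rfl]
    have hs : cubeHalfSpace a s = if 0 ≤ s then Set.univ else ∅ := by
      ext x
      split_ifs with h <;> simp [cubeHalfSpace, h]
    rw [hv, hs]
    split_ifs <;> simp [volume_pi]
  | succ n ih =>
    intro a ha s
    set a' : Fin n → ℝ := fun i => a i.succ with ha'
    have ha'0 : ∀ i, 0 < a' i := fun i => ha _
    set C : ℝ := n.factorial * ∏ i, a' i with hC
    have hCpos : 0 < C := mul_pos (by positivity) (Finset.prod_pos fun i _ => ha'0 i)
    have hint : IntervalIntegrable (fun x => vertexSum n a' (s - a 0 * x)) volume 0 1 := by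
      unfold vertexSum
      have h (x : ℝ) (T : Finset (Fin n)) :
        s - a 0 * x - ∑ i ∈ T, a' i = (s - ∑ i ∈ T, a' i) - a 0 * x := by ring
      simp_rw [h]
      have hsum := IntervalIntegrable.sum Finset.univ fun (T : Finset (Fin n)) _ =>
        (intervalIntegrable_truncPow_affine n (ha 0) (s - ∑ i ∈ T, a' i)).const_mul
          ((-1 : ℝ) ^ T.card)
      convert! hsum using 1
      ext x
      simp
    have hI := integral_vertexSum_affine n a' (ha 0) s
    rw [← Nat.cast_succ, Nat.succ_eq_add_one, ← vertexSum_fin_succ] at hI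
    have hnn : 0 ≤ vertexSum (n + 1) a s / (a 0 * (n + 1 : ℕ)) := by
      rw [← hI]
      exact intervalIntegral.integral_nonneg zero_le_one fun x _ => (ih a' ha'0 _).1
    have hpos : 0 < a 0 * ((n + 1 : ℕ) : ℝ) := mul_pos (ha 0) (by positivity)
    refine ⟨by
      have := mul_nonneg hnn hpos.le
      rwa [div_mul_cancel₀ _ hpos.ne'] at this, ?_⟩
    have hmp := (volume_preserving_piFinSuccAbove (fun _ : Fin (n + 1) => ℝ) 0).symm
    rw [← hmp.measure_preimage (measurableSet_cubeHalfSpace a s).nullMeasurableSet,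
      Measure.volume_eq_prod, Measure.prod_apply
        ((MeasurableEquiv.measurable _) (measurableSet_cubeHalfSpace a s))]
    have hsec (x : ℝ) : volume (Prod.mk x ⁻¹'
        ((MeasurableEquiv.piFinSuccAbove (fun _ : Fin (n + 1) => ℝ) 0).symm ⁻¹' cubeHalfSpace a s))
        = (Set.Icc (0 : ℝ) 1).indicator
            (fun x => ENNReal.ofReal (vertexSum n a' (s - a 0 * x) / C)) x := by
      by_cases hx : x ∈ Set.Icc (0 : ℝ) 1
      · rw [Set.indicator_of_mem hx, ← (ih a' ha'0 _).2]
        congr 1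
        ext y
        simp only [cubeHalfSpace, Set.mem_preimage, Set.mem_ofPred_eq, Fin.sum_univ_succ,
          Fin.forall_fin_succ, MeasurableEquiv.piFinSuccAbove_symm_apply, Fin.insertNth_zero',
          ha', Fin.insertNthEquiv]
        constructor
        · rintro ⟨⟨-, h⟩, h'⟩
          exact ⟨h, by simp_all; linarith⟩
        · rintro ⟨h, h'⟩
          exact ⟨⟨hx, h⟩, by simp_all; linarith⟩
      · rw [Set.indicator_of_notMem hx]
        convert measure_empty (μ := volume)
        ext y
        simp only [cubeHalfSpace, Set.mem_preimage, Set.mem_ofPred_eq, Set.mem_empty_iff_false,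
          iff_false, Fin.forall_fin_succ]
        rintro ⟨⟨h, -⟩, -⟩
        exact hx (by simpa using h)
    simp_rw [hsec]
    rw [lintegral_indicator measurableSet_Icc, ← ofReal_integral_eq_lintegral_ofReal]
    · rw [integral_Icc_eq_integral_Ioc, ← intervalIntegral.integral_of_le zero_le_one,
        intervalIntegral.integral_div, hI, hC, Fin.prod_univ_succ, Nat.factorial_succ]
      congr 1
      push_cast
      rw [div_div]
      congr 1
      simp only [ha']
      ring
    · exact (intervalIntegrable_iff_integrableOn_Icc_of_le zero_le_one (by simp)).1
        (hint.div_const C)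
    · exact Filter.Eventually.of_forall fun x => div_nonneg (ih a' ha'0 _).1 hCpos.le

/-! ### The volume of a section of the cube -/

theorem volume_setOf_sum_mul_eq {ι : Type*} [Fintype ι] {a : ι → ℝ} {i : ι} (hi : a i ≠ 0) (s : ℝ) :
    volume {x : ι → ℝ | ∑ i, a i * x i = s} = 0 := by
  classical
  rcases Set.eq_empty_or_nonempty {x : ι → ℝ | ∑ i, a i * x i = s} with h | ⟨x₀, hx₀⟩
  · rw [h, measure_empty]
  let f : (ι → ℝ) →ₗ[ℝ] ℝ := ∑ i, a i • LinearMap.proj i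
  have hf (x : ι → ℝ) : f x = ∑ i, a i * x i := by simp [f]
  have hset : {x : ι → ℝ | ∑ i, a i * x i = s} =
      ((AffineSubspace.mk' x₀ (LinearMap.ker f) : AffineSubspace ℝ (ι → ℝ)) : Set (ι → ℝ)) := by
    ext x
    rw [SetLike.mem_coe, AffineSubspace.mem_mk', LinearMap.mem_ker, vsub_eq_sub, map_sub, hf, hf,
      Set.mem_ofPred_eq, show ∑ i, a i * x₀ i = s from hx₀, sub_eq_zero]
  rw [hset]
  refine Measure.addHaar_affineSubspace _ _ fun htop => hi ?_
  have hmem : x₀ + Pi.single i 1 ∈ (AffineSubspace.mk' x₀ (LinearMap.ker f)) := by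
    rw [htop]; trivial
  rw [AffineSubspace.mem_mk', LinearMap.mem_ker, vsub_eq_sub, add_sub_cancel_left, hf] at hmem
  simpa [Pi.single_apply] using hmem

/-- The part of the cube `[0,1]^ι` in the slab `s ≤ ∑ i, a i * x i ≤ s'`. -/
def cubeSlab {ι : Type*} [Fintype ι] (a : ι → ℝ) (s s' : ℝ) : Set (ι → ℝ) :=
  {x | (∀ i, 0 ≤ x i ∧ x i ≤ 1) ∧ s ≤ ∑ i, a i * x i ∧ ∑ i, a i * x i ≤ s'}

/-- The slab is the difference of two half-spaces up to a null set, and the corresponding difference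
of vertex sums is the vertex sum in one more variable. -/
theorem volume_cubeSlab {n : ℕ} (hn : 0 < n) (a : Fin (n + 1) → ℝ) (ha : ∀ i, 0 < a i) (b : ℝ) :
    0 ≤ vertexSum n a b ∧ volume (cubeSlab (fun i : Fin n => a i.succ) (b - a 0) b)
      = ENNReal.ofReal (vertexSum n a b / (n.factorial * ∏ i : Fin n, a i.succ)) := by
  set a' : Fin n → ℝ := fun i => a i.succ
  have ha' : ∀ i, 0 < a' i := fun i => ha _
  have hC : (0 : ℝ) < n.factorial * ∏ i, a' i :=
    mul_pos (by positivity) (Finset.prod_pos fun i _ => ha' i)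
  obtain ⟨h1, h1'⟩ := volume_cubeHalfSpace a' ha' b
  obtain ⟨h2, h2'⟩ := volume_cubeHalfSpace a' ha' (b - a 0)
  have hsub : cubeHalfSpace a' (b - a 0) ⊆ cubeHalfSpace a' b := fun x hx =>
    ⟨hx.1, hx.2.trans (by linarith [ha 0])⟩
  have hle := measure_mono (μ := volume) hsub
  rw [h1', h2', ENNReal.ofReal_le_ofReal_iff (by positivity), div_le_div_iff_of_pos_right hC] at hle
  have hs := vertexSum_fin_succ n a b
  refine ⟨by rw [hs]; linarith, ?_⟩
  have hae : cubeSlab a' (b - a 0) b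
      =ᵐ[volume] (cubeHalfSpace a' b \ cubeHalfSpace a' (b - a 0) : Set (Fin n → ℝ)) := by
    have hnull : ∀ᵐ x : Fin n → ℝ, ¬ ∑ i, a' i * x i = b - a 0 :=
      measure_eq_zero_iff_ae_notMem.1 (volume_setOf_sum_mul_eq (ha' ⟨0, hn⟩).ne' _)
    rw [Filter.eventuallyEq_set]
    filter_upwards [hnull] with x hx
    constructor
    · rintro ⟨hx0, hx1, hx2⟩
      exact ⟨⟨hx0, hx2⟩, fun h => hx (le_antisymm h.2 hx1)⟩
    · rintro ⟨⟨hx0, hx2⟩, hx1⟩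
      exact ⟨hx0, le_of_not_ge fun h => hx1 ⟨hx0, h⟩, hx2⟩
  rw [measure_congr hae, measure_sdiff hsub (measurableSet_cubeHalfSpace _ _).nullMeasurableSet
    (by rw [h2']; exact ENNReal.ofReal_ne_top), h1', h2', ← ENNReal.ofReal_sub _ (by positivity),
    hs, sub_div]

/-- The linear part of the parametrization of the hyperplane `x 0 = c₀ + ∑ i, c i * x (i + 1)` by
the coordinates other than the first. -/
noncomputable def graphMap {n : ℕ} (c : Fin n → ℝ) :
    EuclideanSpace ℝ (Fin n) →ₗ[ℝ] EuclideanSpace ℝ (Fin (n + 1)) where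
  toFun x := WithLp.toLp 2 (Fin.cons (∑ i, c i * x i) fun i => x i)
  map_add' x y := by
    ext i
    refine Fin.cases ?_ (fun j => ?_) i <;> simp [mul_add, Finset.sum_add_distrib]
  map_smul' r x := by
    ext i
    refine Fin.cases ?_ (fun j => ?_) i <;> simp [Finset.mul_sum, mul_left_comm]

@[simp] theorem graphMap_zero {n : ℕ} (c : Fin n → ℝ) (x : EuclideanSpace ℝ (Fin n)) :
    graphMap c x 0 = ∑ i, c i * x i := rfl

@[simp] theorem graphMap_succ {n : ℕ} (c : Fin n → ℝ) (x : EuclideanSpace ℝ (Fin n)) (i : Fin n) :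
    graphMap c x i.succ = x i := rfl

/-- The Gram matrix of the images of the coordinate vectors is the rank-one update `1 + c cᵀ`. -/
theorem normDet_graphMap_sq {n : ℕ} (c : Fin n → ℝ) :
    (graphMap c).normDet ^ 2 = 1 + ∑ i, c i ^ 2 := by
  have h := (graphMap c).normDet_sq_eq_det_gram (EuclideanSpace.basisFun (Fin n) ℝ)
  rw [RCLike.ofReal_real_eq_id, id] at h
  rw [h]
  have hg : Matrix.gram ℝ (fun i => graphMap c (EuclideanSpace.basisFun (Fin n) ℝ i))
      = 1 + Matrix.replicateCol Unit c * Matrix.replicateRow Unit c := by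
    ext i j
    simp [Matrix.gram_apply, PiLp.inner_apply, Fin.sum_univ_succ, Matrix.mul_apply,
      Matrix.one_apply, mul_comm, add_comm, eq_comm]
  rw [hg, Matrix.det_one_add_replicateCol_mul_replicateRow]
  simp [dotProduct, sq]

/-- The section is the graph over the slab in the last `n` coordinates on which the first coordinate
lies in `[0, 1]`. -/
theorem hyperplaneAt_inter_hypercube {n : ℕ} (t : ℝ) (a : EuclideanSpace ℝ (Fin (n + 1)))
    (ha : 0 < a 0) :
    hyperplaneAt t a ∩ hypercube (n + 1) =
      (fun x => EuclideanSpace.single 0 (((∑ i, a i) / 2 - t) / a 0) + x) ''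
        (graphMap (fun i : Fin n => -(a i.succ / a 0)) '' (WithLp.ofLp ⁻¹'
          cubeSlab (fun i : Fin n => a i.succ) ((∑ i, a i) / 2 - t - a 0)
            ((∑ i, a i) / 2 - t))) := by
  set b := (∑ i, a i) / 2 - t with hb
  have hsum (x : Fin n → ℝ) : ∑ i, -(a i.succ / a 0) * x i = -(∑ i, a i.succ * x i) / a 0 := by
    rw [neg_div, Finset.sum_div, ← Finset.sum_neg_distrib]
    exact Finset.sum_congr rfl fun i _ => by ring
  have hinner (x : EuclideanSpace ℝ (Fin (n + 1))) :
      x ∈ hyperplaneAt t a ↔ a 0 * x 0 + ∑ i : Fin n, a i.succ * x i.succ = b := by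
    simp [hyperplaneAt, PiLp.inner_apply, Fin.sum_univ_succ, hb, mul_comm]
  ext x
  rw [Set.image_image]
  constructor
  · rintro ⟨h1, h2⟩
    rw [hinner] at h1
    refine ⟨WithLp.toLp 2 fun i => x i.succ, ⟨fun i => h2 _, ?_, ?_⟩, ?_⟩
    · have := mul_le_mul_of_nonneg_left (h2 0).2 ha.le
      change b - a 0 ≤ ∑ i : Fin n, a i.succ * x i.succ
      linarith
    · have := mul_nonneg ha.le (h2 0).1
      change ∑ i : Fin n, a i.succ * x i.succ ≤ b
      linarith
    · ext i
      refine Fin.cases ?_ (fun j => ?_) i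
      · simp only [PiLp.add_apply, graphMap_zero, hsum]
        simp only [PiLp.single_apply, if_true]
        rw [← add_div, div_eq_iff ha.ne']
        linarith
      · simp
  · rintro ⟨y, ⟨hy, hy1, hy2⟩, rfl⟩
    have e0 : (EuclideanSpace.single 0 (b / a 0) + graphMap (fun i : Fin n => -(a i.succ / a 0)) y :
        EuclideanSpace ℝ (Fin (n + 1))) 0 = (b - ∑ i, a i.succ * y i) / a 0 := by
      simp only [PiLp.add_apply, graphMap_zero, hsum]
      simp only [PiLp.single_apply, if_true]
      ring
    have es (i : Fin n) : (EuclideanSpace.single 0 (b / a 0) +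
        graphMap (fun i : Fin n => -(a i.succ / a 0)) y :
          EuclideanSpace ℝ (Fin (n + 1))) i.succ = y i := by
      simp
    constructor
    · rw [hinner, e0]
      simp_rw [es]
      rw [mul_div_cancel₀ _ ha.ne']
      ring
    · intro i
      refine Fin.cases ?_ (fun j => ?_) i
      · rw [e0]
        exact ⟨div_nonneg (sub_nonneg.2 hy2) ha.le, (div_le_one ha).2 (by linarith)⟩
      · rw [es]
        exact hy j

/-- Pólya's formula for the volume of a section, in the case of a unit normal with positive
coordinates. -/
theorem sectionVolume_eq_vertexSum {n : ℕ} (hn : 0 < n) (t : ℝ)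
    (a : EuclideanSpace ℝ (Fin (n + 1))) (ha : ∀ i, 0 < a i) (hnorm : ‖a‖ = 1) :
    0 ≤ vertexSum n a ((∑ i, a i) / 2 - t) ∧
    sectionVolume t a = ENNReal.ofReal
      (vertexSum n a ((∑ i, a i) / 2 - t) / (n.factorial * ∏ i, a i)) := by
  set b := (∑ i, a i) / 2 - t
  obtain ⟨h1, h2⟩ := volume_cubeSlab hn a ha b
  refine ⟨h1, ?_⟩
  have hdet : (graphMap (fun i : Fin n => -(a i.succ / a 0))).normDet = 1 / a 0 := by
    rw [← sq_eq_sq₀ (LinearMap.normDet_nonneg _) (one_div_pos.2 (ha 0)).le, normDet_graphMap_sq]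
    have hsq : ∑ i, a i ^ 2 = 1 := by
      have := EuclideanSpace.norm_sq_eq a
      simpa [hnorm] using this.symm
    rw [Fin.sum_univ_succ] at hsq
    have : ∑ i : Fin n, (-(a i.succ / a 0)) ^ 2 = (∑ i : Fin n, a i.succ ^ 2) / a 0 ^ 2 := by
      rw [Finset.sum_div]
      exact Finset.sum_congr rfl fun i _ => by ring
    have h0 := (ha 0).ne'
    rw [this]
    field_simp
    linarith
  have himage := LinearMap.euclideanHausdorffMeasure_image_eq_normDet_mul_volume
    (graphMap (fun i : Fin n => -(a i.succ / a 0)))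
    (WithLp.ofLp ⁻¹' cubeSlab (fun i : Fin n => a i.succ) (b - a 0) b)
  rw [finrank_euclideanSpace_fin, hdet, (PiLp.volume_preserving_ofLp (Fin n)).measure_preimage_emb
    (MeasurableEquiv.toLp 2 (Fin n → ℝ)).symm.measurableEmbedding, h2] at himage
  rw [sectionVolume, hyperplaneAt_inter_hypercube t a (ha 0), Nat.add_sub_cancel,
    (isometry_add_left _).euclideanHausdorffMeasure_image, himage,
    ← ENNReal.ofReal_mul (one_div_pos.2 (ha 0)).le, Fin.prod_univ_succ]
  congr 1
  rw [div_mul_div_comm, one_mul]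
  congr 1
  ring

/-- The isometry `x i ↦ x i` or `x i ↦ 1 - x i`, according to the sign `ε i`, carries one section to
the other. -/
theorem sectionVolume_mul_sign {d : ℕ} (t : ℝ) (a : EuclideanSpace ℝ (Fin d)) {ε : Fin d → ℝ}
    (hε : ∀ i, ε i ^ 2 = 1) :
    sectionVolume t (WithLp.toLp 2 fun i => ε i * a i : EuclideanSpace ℝ (Fin d))
      = sectionVolume t a := by
  let Ψ : EuclideanSpace ℝ (Fin d) → EuclideanSpace ℝ (Fin d) :=
    fun x => WithLp.toLp 2 fun i => ε i * x i + (1 - ε i) / 2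
  have hΨ : Isometry Ψ := by
    refine Isometry.of_dist_eq fun x y => ?_
    rw [EuclideanSpace.dist_eq, EuclideanSpace.dist_eq]
    congr 1
    refine Finset.sum_congr rfl fun i _ => ?_
    rw [Real.dist_eq, Real.dist_eq, sq_abs, sq_abs]
    simp only [Ψ]
    linear_combination (x i - y i) ^ 2 * hε i
  have hsurj : Function.Surjective Ψ := by
    refine Function.Involutive.surjective fun x => ?_
    ext i
    simp only [Ψ]
    linear_combination (x i - 1 / 2) * hε i
  have hpre : Ψ ⁻¹' (hyperplaneAt t (WithLp.toLp 2 fun i => ε i * a i) ∩ hypercube d)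
      = hyperplaneAt t a ∩ hypercube d := by
    ext x
    rw [Set.preimage_inter]
    refine and_congr ?_ (forall_congr' fun i => ?_)
    · simp only [hyperplaneAt, Set.mem_preimage, Set.mem_ofPred_eq, PiLp.inner_apply, Ψ,
        RCLike.inner_apply, conj_trivial]
      have : ∑ i, (ε i * x i + (1 - ε i) / 2) * (ε i * a i)
          = ∑ i, x i * a i + (∑ i, ε i * a i) / 2 - (∑ i, a i) / 2 := by
        rw [Finset.sum_div, Finset.sum_div, ← Finset.sum_add_distrib, ← Finset.sum_sub_distrib]
        refine Finset.sum_congr rfl fun i _ => ?_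
        linear_combination (x i * a i - a i / 2) * hε i
      rw [this]
      constructor <;> intro h <;> linarith
    · simp only [Ψ]
      rcases mul_self_eq_one_iff.1 ((sq (ε i)).symm.trans (hε i)) with h | h
      · rw [h]; norm_num
      · rw [h]
        constructor <;> rintro ⟨h1, h2⟩ <;> constructor <;> linarith
  rw [sectionVolume, sectionVolume, ← hpre, hΨ.euclideanHausdorffMeasure_preimage, hsurj.range_eq,
    Set.inter_univ]

/-! ### First-order expansions -/

open Asymptotics Filter

/-- `f = c₀ + c₁ q + o(q)` along `l`. -/
def HasFirstOrderExpansion {α : Type*} (l : Filter α) (q f : α → ℝ) (c₀ c₁ : ℝ) : Prop :=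
  (fun u => f u - (c₀ + c₁ * q u)) =o[l] q

namespace HasFirstOrderExpansion

variable {α : Type*} {l : Filter α} {q f g : α → ℝ} {c₀ c₁ e₀ e₁ : ℝ}

theorem congr_coeff (hf : HasFirstOrderExpansion l q f c₀ c₁) (h₀ : c₀ = e₀) (h₁ : c₁ = e₁) :
    HasFirstOrderExpansion l q f e₀ e₁ := h₀ ▸ h₁ ▸ hf

theorem sub_const_isBigO (hf : HasFirstOrderExpansion l q f c₀ c₁) :
    (fun u => f u - c₀) =O[l] q := by
  refine (hf.isBigO.add ((isBigO_refl q l).const_mul_left c₁)).congr_left fun u => ?_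
  ring

theorem tendsto (hf : HasFirstOrderExpansion l q f c₀ c₁) (hq : Tendsto q l (𝓝 0)) :
    Tendsto f l (𝓝 c₀) := by
  simpa using (hf.sub_const_isBigO.trans_tendsto hq).add_const c₀

theorem mul (hf : HasFirstOrderExpansion l q f c₀ c₁) (hg : HasFirstOrderExpansion l q g e₀ e₁)
    (hq : Tendsto q l (𝓝 0)) :
    HasFirstOrderExpansion l q (fun u => f u * g u) (c₀ * e₀) (c₀ * e₁ + c₁ * e₀) := by
  have h1 : (fun u => (f u - c₀) * (g u - e₀)) =o[l] q := by
    have ho : (fun u => f u - c₀) =o[l] (fun _ => (1 : ℝ)) :=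
      (isLittleO_one_iff ℝ).2 (hf.sub_const_isBigO.trans_tendsto hq)
    simpa using ho.mul_isBigO hg.sub_const_isBigO
  refine ((h1.add (IsLittleO.const_mul_left hg c₀)).add (IsLittleO.const_mul_left hf e₀)).congr_left
    fun u => ?_
  ring

/-- A nonzero first-order coefficient decides the sign of `f - c₀`. -/
theorem eventually_lt (hf : HasFirstOrderExpansion l q f c₀ c₁) (hq : ∀ᶠ u in l, 0 < q u)
    (h : c₁ < 0) : ∀ᶠ u in l, f u < c₀ := by
  filter_upwards [hf.def (c := -c₁ / 2) (by linarith), hq] with u hu hqu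
  rw [Real.norm_of_nonneg hqu.le, Real.norm_eq_abs] at hu
  nlinarith [le_abs_self (f u - (c₀ + c₁ * q u))]

theorem eventually_gt (hf : HasFirstOrderExpansion l q f c₀ c₁) (hq : ∀ᶠ u in l, 0 < q u)
    (h : 0 < c₁) : ∀ᶠ u in l, c₀ < f u := by
  filter_upwards [hf.def (c := c₁ / 2) (by linarith), hq] with u hu hqu
  rw [Real.norm_of_nonneg hqu.le, Real.norm_eq_abs] at hu
  nlinarith [neg_abs_le (f u - (c₀ + c₁ * q u))]

theorem inv (hf : HasFirstOrderExpansion l q f 1 c₁) (hq : Tendsto q l (𝓝 0)) :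
    HasFirstOrderExpansion l q (fun u => (f u)⁻¹) 1 (-c₁) := by
  have hlim := hf.tendsto hq
  have hinv : Tendsto (fun u => (f u)⁻¹) l (𝓝 1) := by simpa using hlim.inv₀ one_ne_zero
  have hsub : (fun u => f u - 1) =o[l] (fun _ => (1 : ℝ)) :=
    (isLittleO_one_iff ℝ).2 (by simpa using hlim.sub_const 1)
  have h1 : (fun u => c₁ * (f u - 1) * q u) =o[l] q := by
    simpa using (hsub.const_mul_left c₁).mul_isBigO (isBigO_refl q l)
  have h2 := (hinv.isBigO_one ℝ).mul_isLittleO (h1.sub hf)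
  simp only [one_mul] at h2
  refine h2.congr' ?_ EventuallyEq.rfl
  filter_upwards [hlim.eventually_ne one_ne_zero] with u hu
  field_simp
  ring

end HasFirstOrderExpansion

/-! ### Taylor expansion of the truncated power -/

theorem exists_pow_add_eq (m : ℕ) (x : ℝ) : ∃ k : ℝ → ℝ, Continuous k ∧ ∀ h : ℝ,
    (x + h) ^ (m + 2) = x ^ (m + 2) + (m + 2) * x ^ (m + 1) * h
      + (m + 2) * (m + 1) / 2 * x ^ m * h ^ 2 + h ^ 3 * k h := by
  induction m with
  | zero => exact ⟨fun _ => 0, continuous_const, fun h => by norm_num; ring⟩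
  | succ m ih =>
    obtain ⟨k, hk, hk'⟩ := ih
    refine ⟨fun h => (m + 2) * (m + 1) / 2 * x ^ m + (x + h) * k h, by fun_prop, fun h => ?_⟩
    rw [pow_succ, hk' h]
    push_cast
    ring

/-- The function `x₊^(m+3)` is twice continuously differentiable, also at `0`. -/
theorem truncPow_taylor (m : ℕ) (x : ℝ) :
    (fun h => truncPow (m + 3) (x + h) - (truncPow (m + 3) x + (m + 3) * truncPow (m + 2) x * h
      + (m + 3) * (m + 2) / 2 * truncPow (m + 1) x * h ^ 2)) =o[𝓝 0] fun h : ℝ => h ^ 2 := by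
  have hid : (fun h : ℝ => h) =o[𝓝 0] fun _ => (1 : ℝ) := (isLittleO_one_iff ℝ).2 tendsto_id
  have hadd : Tendsto (fun h => x + h) (𝓝 0) (𝓝 x) := by
    simpa using (continuous_const.add continuous_id).tendsto (0 : ℝ) (f := fun h => x + h)
  rcases lt_trichotomy x 0 with hx | rfl | hx
  · refine (isLittleO_zero _ _).congr' ?_ EventuallyEq.rfl
    filter_upwards [hadd.eventually_lt_const hx] with h hh
    simp [truncPow_of_neg hx, truncPow_of_neg hh]
  · have hO : (fun h : ℝ => h * h ^ 2) =o[𝓝 0] fun h : ℝ => h ^ 2 := by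
      simpa using hid.mul_isBigO (isBigO_refl (fun h : ℝ => h ^ 2) (𝓝 0))
    refine IsBigO.trans_isLittleO (IsBigO.of_bound 1 ?_) hO
    filter_upwards [Ioo_mem_nhds (show (-1 : ℝ) < 0 by norm_num) one_pos] with h hh
    have h1 : |h| ≤ 1 := abs_le.2 ⟨hh.1.le, hh.2.le⟩
    have h3 : |truncPow (m + 3) h| ≤ |h| ^ 3 := by
      rcases le_or_gt 0 h with h0 | h0
      · rw [truncPow_of_nonneg h0, abs_pow, pow_add]
        exact mul_le_of_le_one_left (by positivity) (pow_le_one₀ (abs_nonneg h) h1)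
      · rw [truncPow_of_neg h0, abs_zero]
        positivity
    simpa [truncPow_of_nonneg le_rfl, ← pow_succ', Real.norm_eq_abs, ← abs_pow, abs_mul] using h3
  · obtain ⟨k, hk, hk'⟩ := exists_pow_add_eq (m + 1) x
    have hO : (fun h : ℝ => h * k h * h ^ 2) =o[𝓝 0] fun h : ℝ => h ^ 2 := by
      have h1 : (fun h => h * k h) =o[𝓝 0] fun _ => (1 : ℝ) := by
        simpa using hid.mul_isBigO ((hk.tendsto 0).isBigO_one ℝ)
      simpa using h1.mul_isBigO (isBigO_refl (fun h : ℝ => h ^ 2) (𝓝 0))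
    refine hO.congr' ?_ EventuallyEq.rfl
    filter_upwards [hadd.eventually_const_lt hx] with h hh
    rw [truncPow_of_nonneg hx.le, truncPow_of_nonneg hx.le, truncPow_of_nonneg hx.le,
      truncPow_of_nonneg hh.le, hk' h]
    push_cast
    ring

/-! ### Second-order expansions on the tangent space -/

theorem tendsto_sum_apply {ι : Type*} (s : Finset ι) :
    Tendsto (fun u : ι → ℝ => ∑ i ∈ s, u i) (𝓝 0) (𝓝 0) := by
  have : Continuous fun u : ι → ℝ => ∑ i ∈ s, u i := by fun_prop
  simpa using this.tendsto (0 : ι → ℝ)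

section Tangent

variable {ι : Type*} [Fintype ι]

/-- The squared Euclidean norm of a vector of `ι → ℝ`. -/
def sqNorm (u : ι → ℝ) : ℝ := ∑ i, u i ^ 2

theorem tendsto_sqNorm : Tendsto (sqNorm (ι := ι)) (𝓝 0) (𝓝 0) := by
  have : Continuous (sqNorm (ι := ι)) := by unfold sqNorm; fun_prop
  simpa [sqNorm] using this.tendsto (0 : ι → ℝ)

theorem isBigO_sum_sq (s : Finset ι) (l : Filter (ι → ℝ)) :
    (fun u : ι → ℝ => (∑ i ∈ s, u i) ^ 2) =O[l] sqNorm := by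
  refine IsBigO.of_bound s.card (Eventually.of_forall fun u => ?_)
  have h1 : 0 ≤ sqNorm u := Finset.sum_nonneg fun i _ => sq_nonneg _
  rw [Real.norm_of_nonneg (sq_nonneg _), Real.norm_of_nonneg h1]
  refine sq_sum_le_card_mul_sum_sq.trans (mul_le_mul_of_nonneg_left ?_ (Nat.cast_nonneg _))
  exact Finset.sum_le_sum_of_subset_of_nonneg (Finset.subset_univ s) fun i _ _ => sq_nonneg _

theorem isBigO_sq_sum (s : Finset ι) (l : Filter (ι → ℝ)) :
    (fun u : ι → ℝ => ∑ i ∈ s, u i ^ 2) =O[l] sqNorm := by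
  refine IsBigO.of_bound 1 (Eventually.of_forall fun u => ?_)
  have h1 : 0 ≤ sqNorm u := Finset.sum_nonneg fun i _ => sq_nonneg _
  rw [Real.norm_of_nonneg (Finset.sum_nonneg fun i _ => sq_nonneg _), Real.norm_of_nonneg h1,
    one_mul]
  exact Finset.sum_le_sum_of_subset_of_nonneg (Finset.subset_univ s) fun i _ _ => sq_nonneg _

/-- The second-order expansion of a product in terms of the power sums of `u`. -/
theorem prod_one_add_sub_isLittleO (s : Finset ι) :
    (fun u : ι → ℝ => ∏ i ∈ s, (1 + u i)
      - (1 + ∑ i ∈ s, u i + ((∑ i ∈ s, u i) ^ 2 - ∑ i ∈ s, u i ^ 2) / 2)) =o[𝓝 0] sqNorm := by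
  classical
  induction s using Finset.induction_on with
  | empty => simp
  | insert j s hj ih =>
    have hjlim : Tendsto (fun u : ι → ℝ => u j) (𝓝 0) (𝓝 0) := by
      simpa using tendsto_sum_apply ({j} : Finset ι)
    have h1 : (fun u : ι → ℝ => 1 + u j) =O[𝓝 0] fun _ => (1 : ℝ) :=
      (hjlim.const_add 1).isBigO_one ℝ
    have h2 : (fun u : ι → ℝ => u j) =o[𝓝 0] fun _ => (1 : ℝ) := (isLittleO_one_iff ℝ).2 hjlim
    have h3 := h2.mul_isBigO ((isBigO_sum_sq s (𝓝 0)).sub (isBigO_sq_sum s (𝓝 0)))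
    have h4 := h1.mul_isLittleO ih
    simp only [one_mul] at h3 h4
    refine (h4.add (h3.const_mul_left (1 / 2))).congr_left fun u => ?_
    rw [Finset.prod_insert hj, Finset.sum_insert hj, Finset.sum_insert hj]
    ring

/-- The filter of neighborhoods of `0` in the hyperplane `∑ i, u i = 0`, which is the tangent space
of the sphere at the diagonal direction. -/
def tangentNhds (ι : Type*) [Fintype ι] : Filter (ι → ℝ) := 𝓝[{u | ∑ i, u i = 0}] 0

theorem tangentNhds_le : tangentNhds ι ≤ 𝓝 0 := nhdsWithin_le_nhds

theorem tendsto_sqNorm_tangentNhds : Tendsto (sqNorm (ι := ι)) (tangentNhds ι) (𝓝 0) :=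
  tendsto_sqNorm.mono_left tangentNhds_le

theorem eventually_sum_eq_zero : ∀ᶠ u in tangentNhds ι, ∑ i, u i = 0 :=
  eventually_mem_nhdsWithin

theorem expansion_prod_inv :
    HasFirstOrderExpansion (tangentNhds ι) sqNorm (fun u => (∏ i, (1 + u i))⁻¹) 1 (1 / 2) := by
  have h : HasFirstOrderExpansion (tangentNhds ι) sqNorm
      (fun u => ∏ i, (1 + u i)) 1 (-(1 / 2)) := by
    refine ((prod_one_add_sub_isLittleO Finset.univ).mono tangentNhds_le).congr'
      ?_ EventuallyEq.rfl
    filter_upwards [eventually_sum_eq_zero] with u hu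
    simp only [hu, sqNorm]
    ring
  exact (h.inv tendsto_sqNorm_tangentNhds).congr_coeff rfl (by norm_num)

theorem expansion_sqrt {D : ℝ} (hD : 0 < D) : HasFirstOrderExpansion (tangentNhds ι) sqNorm
    (fun u => √(D + sqNorm u)) √D (1 / (2 * √D)) := by
  have hlim : Tendsto (fun u : ι → ℝ => √(D + sqNorm u)) (tangentNhds ι) (𝓝 √D) := by
    simpa [Function.comp_def] using (Real.continuous_sqrt.tendsto (D + 0)).comp
      ((tendsto_sqNorm_tangentNhds (ι := ι)).const_add D)
  have hs : 0 < √D := Real.sqrt_pos.2 hD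
  have h1 : (fun u : ι → ℝ => (√(D + sqNorm u) + √D)⁻¹ - (√D + √D)⁻¹)
      =o[tangentNhds ι] fun _ => (1 : ℝ) := by
    rw [isLittleO_one_iff]
    have := ((hlim.add_const √D).inv₀ (by positivity)).sub_const (√D + √D)⁻¹
    simpa using this
  have h2 := h1.mul_isBigO (isBigO_refl sqNorm (tangentNhds ι))
  simp only [one_mul] at h2
  -- `√(D + q) - √D = q / (√(D + q) + √D)`, and the denominator tends to `2 √D`.
  refine h2.congr_left fun u => ?_
  have hq : 0 ≤ sqNorm u := Finset.sum_nonneg fun i _ => sq_nonneg _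
  have hr := Real.sq_sqrt (add_nonneg hD.le hq)
  have hr' := Real.sq_sqrt hD.le
  have hr0 : 0 ≤ √(D + sqNorm u) := Real.sqrt_nonneg _
  set r := √(D + sqNorm u)
  have hqe : sqNorm u = (r - √D) * (r + √D) := by nlinarith
  rw [hqe]
  have : r + √D ≠ 0 := by positivity
  field_simp
  ring

/-- The contribution of one vertex: the remainder after the constant, linear and quadratic terms. -/
theorem truncPow_vertex_isLittleO (m : ℕ) {D : ℝ} (hD : 0 < D) (t x : ℝ) (T : Finset ι) :
    (fun u : ι → ℝ => truncPow (m + 3) (x + (-(∑ i ∈ T, u i) - t * (√(D + sqNorm u) - √D)))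
      - (truncPow (m + 3) x
        + (m + 3) * truncPow (m + 2) x * (-(∑ i ∈ T, u i) - t / (2 * √D) * sqNorm u)
        + (m + 3) * (m + 2) / 2 * truncPow (m + 1) x * (∑ i ∈ T, u i) ^ 2))
      =o[tangentNhds ι] sqNorm := by
  have hr := expansion_sqrt (ι := ι) hD
  have hrO := hr.sub_const_isBigO
  have hq := tendsto_sqNorm_tangentNhds (ι := ι)
  have hrlim : Tendsto (fun u : ι → ℝ => √(D + sqNorm u) - √D) (tangentNhds ι) (𝓝 0) :=
    hrO.trans_tendsto hq
  have hulim : Tendsto (fun u : ι → ℝ => ∑ i ∈ T, u i) (tangentNhds ι) (𝓝 0) :=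
    (tendsto_sum_apply T).mono_left tangentNhds_le
  set r : (ι → ℝ) → ℝ := fun u => √(D + sqNorm u) - √D with hrdef
  set S : (ι → ℝ) → ℝ := fun u => ∑ i ∈ T, u i with hS
  have hhlim : Tendsto (fun u => -(S u) - t * r u) (tangentNhds ι) (𝓝 0) := by
    simpa using hulim.neg.sub (hrlim.const_mul t)
  -- `r = O(q)` and `S → 0`, so the increment squared agrees with `S²` up to `o(q)`.
  have hsq : (fun u => (-(S u) - t * r u) ^ 2 - S u ^ 2) =o[tangentNhds ι] sqNorm := by
    have h1 : (fun u => 2 * t * S u + t ^ 2 * r u) =o[tangentNhds ι] fun _ => (1 : ℝ) := by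
      rw [isLittleO_one_iff]
      simpa using (hulim.const_mul (2 * t)).add (hrlim.const_mul (t ^ 2))
    have h2 := h1.mul_isBigO hrO
    simp only [one_mul] at h2
    exact h2.congr_left fun u => by ring
  have hsqO : (fun u => (-(S u) - t * r u) ^ 2) =O[tangentNhds ι] sqNorm :=
    (hsq.isBigO.add (isBigO_sum_sq T _)).congr_left fun u => by ring
  have h1 := ((truncPow_taylor m x).comp_tendsto hhlim).trans_isBigO hsqO
  have h2 := hsq.const_mul_left ((m + 3) * (m + 2) / 2 * truncPow (m + 1) x)
  have h3 := IsLittleO.const_mul_left hr (-t * ((m + 3) * truncPow (m + 2) x))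
  refine ((h1.add h2).add h3).congr_left fun u => ?_
  simp only [Function.comp_apply, hrdef]
  field_simp
  ring

end Tangent

/-! ### Weighted sums over subsets -/

section Counting

variable {ι : Type*} [Fintype ι] [DecidableEq ι]

/-- The sum of the weights `c |T|` over the subsets `T` that contain both `i` and `j`. -/
def pairWeight (c : ℕ → ℝ) (i j : ι) : ℝ :=
  ∑ T : Finset ι, c T.card * ((if i ∈ T then 1 else 0) * (if j ∈ T then 1 else 0))

theorem pairWeight_comm (c : ℕ → ℝ) (i j : ι) : pairWeight c i j = pairWeight c j i := by
  unfold pairWeight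
  exact Finset.sum_congr rfl fun T _ => by ring

theorem pairWeight_perm (c : ℕ → ℝ) (π : Equiv.Perm ι) (i j : ι) :
    pairWeight c (π i) (π j) = pairWeight c i j := by
  unfold pairWeight
  refine (Fintype.sum_equiv π.finsetCongr _ _ fun T => ?_).symm
  simp [Equiv.finsetCongr_apply]

/-- The matrix `pairWeight c` commutes with permutations, hence has a constant diagonal and constant
off-diagonal entries. -/
theorem exists_pairWeight_eq (c : ℕ → ℝ) :
    ∃ α β : ℝ, ∀ i j : ι, pairWeight c i j = β + (if i = j then α - β else 0) := by
  have hdiag (i k : ι) : pairWeight c i i = pairWeight c k k := by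
    simpa using (pairWeight_perm c (Equiv.swap i k) i i).symm
  have hrow {i j k : ι} (hij : i ≠ j) (hkj : k ≠ j) : pairWeight c i j = pairWeight c k j := by
    have := (pairWeight_perm c (Equiv.swap i k) i j).symm
    rwa [Equiv.swap_apply_left, Equiv.swap_apply_of_ne_of_ne hij.symm hkj.symm] at this
  have hoff {i j k l : ι} (hij : i ≠ j) (hkl : k ≠ l) : pairWeight c i j = pairWeight c k l := by
    by_cases hkj : k = j
    · subst hkj
      rw [pairWeight_comm c k l]
      exact hrow hij hkl.symm
    · rw [hrow hij hkj, pairWeight_comm c k j, hrow (Ne.symm hkj) hkl.symm, pairWeight_comm c l k]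
  rcases isEmpty_or_nonempty ι with h | ⟨⟨i₀⟩⟩
  · exact ⟨0, 0, fun i => isEmptyElim i⟩
  by_cases hne : ∃ k l : ι, k ≠ l
  · obtain ⟨k, l, hkl⟩ := hne
    refine ⟨pairWeight c i₀ i₀, pairWeight c k l, fun i j => ?_⟩
    split_ifs with h
    · rw [h, hdiag j i₀]; ring
    · rw [hoff h hkl, add_zero]
  · push Not at hne
    refine ⟨pairWeight c i₀ i₀, 0, fun i j => ?_⟩
    rw [hne i i₀, hne j i₀]
    simp

theorem sum_eq_sum_indicator_mul (u : ι → ℝ) (T : Finset ι) :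
    ∑ i ∈ T, u i = ∑ i, (if i ∈ T then 1 else 0) * u i := by
  simp

theorem sum_weight_mul_sum_sq (c : ℕ → ℝ) (u : ι → ℝ) :
    ∑ T : Finset ι, c T.card * (∑ i ∈ T, u i) ^ 2 = ∑ i, ∑ j, pairWeight c i j * (u i * u j) := by
  simp_rw [sum_eq_sum_indicator_mul u, sq, Finset.sum_mul_sum, Finset.mul_sum, pairWeight,
    Finset.sum_mul]
  rw [Finset.sum_comm]
  refine Finset.sum_congr rfl fun i _ => ?_
  rw [Finset.sum_comm]
  exact Finset.sum_congr rfl fun j _ => Finset.sum_congr rfl fun T _ => by ring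

theorem sum_weight_mul_sum (c : ℕ → ℝ) (u : ι → ℝ) :
    ∑ T : Finset ι, c T.card * ∑ i ∈ T, u i = ∑ i, pairWeight c i i * u i := by
  simp_rw [sum_eq_sum_indicator_mul u, Finset.mul_sum, pairWeight, Finset.sum_mul]
  rw [Finset.sum_comm]
  refine Finset.sum_congr rfl fun i _ => Finset.sum_congr rfl fun T _ => ?_
  split_ifs <;> ring

theorem sum_weight_mul_sum_eq_zero (c : ℕ → ℝ) {u : ι → ℝ} (hu : ∑ i, u i = 0) :
    ∑ T : Finset ι, c T.card * ∑ i ∈ T, u i = 0 := by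
  obtain ⟨α, β, h⟩ := exists_pairWeight_eq (ι := ι) c
  rw [sum_weight_mul_sum]
  simp_rw [h, if_true]
  rw [← Finset.mul_sum, hu, mul_zero]

/-- The variance of a sum over a random subset of given size: both sides are multiples of the
difference between the diagonal and the off-diagonal entries of `pairWeight c`, and the constant is
found by counting the elements of `T` and the pairs of elements of `T`. -/
theorem sum_weight_mul_sum_sq_eq (c : ℕ → ℝ) {u : ι → ℝ} (hu : ∑ i, u i = 0) :
    (Fintype.card ι : ℝ) * (Fintype.card ι - 1) * ∑ T : Finset ι, c T.card * (∑ i ∈ T, u i) ^ 2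
      = (∑ T : Finset ι, c T.card * (T.card * (Fintype.card ι - T.card))) * sqNorm u := by
  obtain ⟨α, β, h⟩ := exists_pairWeight_eq (ι := ι) c
  have hgen (v : ι → ℝ) : ∑ T : Finset ι, c T.card * (∑ i ∈ T, v i) ^ 2
      = β * (∑ i, v i) ^ 2 + (α - β) * sqNorm v := by
    rw [sum_weight_mul_sum_sq, sq, Finset.sum_mul_sum, sqNorm, Finset.mul_sum, Finset.mul_sum,
      ← Finset.sum_add_distrib]
    refine Finset.sum_congr rfl fun i _ => ?_
    simp_rw [h, add_mul, Finset.sum_add_distrib, ← Finset.mul_sum]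
    simp [sq]
  have h1 : ∑ T : Finset ι, c T.card * T.card = Fintype.card ι * α := by
    have := sum_weight_mul_sum c (fun _ : ι => (1 : ℝ))
    simp_rw [h] at this
    simpa using this
  have h2 := hgen fun _ => 1
  have h3 := hgen u
  simp only [sqNorm, Finset.sum_const, nsmul_eq_mul, mul_one, one_pow, Finset.card_univ] at h2
  have h4 : ∑ T : Finset ι, c T.card * (T.card * (Fintype.card ι - T.card) : ℝ)
      = Fintype.card ι * (∑ T : Finset ι, c T.card * T.card)
        - ∑ T : Finset ι, c T.card * (T.card : ℝ) ^ 2 := by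
    rw [Finset.mul_sum, ← Finset.sum_sub_distrib]
    exact Finset.sum_congr rfl fun T _ => by ring
  rw [h3, hu, h4, h1, h2]
  ring

end Counting

/-! ### The expansion of the volume near a diagonal -/

/-- The signed sum over vertices that appears as the second-order coefficient of the volume is the
diagonal sum. -/
theorem sum_truncPow_mul_quadP (m : ℕ) {z : ℝ} (hz : 0 ≤ z) (hz' : z < (m + 4 : ℕ)) :
    ∑ T : Finset (Fin (m + 4)), (-1 : ℝ) ^ T.card *
      (truncPow (m + 1) (z - T.card) * quadP T.card (m + 4) z) = diagonalSum (m + 4) z := by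
  have h := Finset.sum_powerset_apply_card
    (fun k => (-1 : ℝ) ^ k * (truncPow (m + 1) (z - k) * quadP k (m + 4) z))
    (x := (Finset.univ : Finset (Fin (m + 4))))
  rw [Finset.powerset_univ, Finset.card_univ, Fintype.card_fin] at h
  rw [h, diagonalSum]
  have hle : ⌊z⌋₊ + 1 ≤ m + 4 + 1 := by
    have : ⌊z⌋₊ < m + 4 := (Nat.floor_lt hz).2 hz'
    omega
  symm
  refine Finset.sum_subset_zero_on_sdiff (Finset.range_subset_range.2 hle) (fun k hk => ?_)
    fun k hk => ?_
  · rw [Finset.mem_sdiff, Finset.mem_range, Finset.mem_range, not_lt] at hk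
    rw [truncPow_of_neg]
    · simp
    · have := Nat.lt_of_floor_lt (Nat.lt_of_succ_le hk.2)
      linarith
  · have hk' : (k : ℝ) ≤ z :=
      (Nat.cast_le.2 (Nat.lt_succ_iff.1 (Finset.mem_range.1 hk))).trans (Nat.floor_le hz)
    rw [truncPow_of_nonneg (sub_nonneg.2 hk'), show m + 4 - 3 = m + 1 by omega, nsmul_eq_mul]
    ring

theorem truncPow_succ_eq_mul (m : ℕ) (x : ℝ) : truncPow (m + 1) x = x * truncPow m x := by
  rcases le_or_gt 0 x with h | h
  · rw [truncPow_of_nonneg h, truncPow_of_nonneg h, pow_succ']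
  · rw [truncPow_of_neg h, truncPow_of_neg h, mul_zero]

theorem vertexSum_mul {ι : Type*} [Fintype ι] (m : ℕ) (a : ι → ℝ) (s : ℝ) {c : ℝ} (hc : 0 < c) :
    vertexSum m (fun i => c * a i) (c * s) = c ^ m * vertexSum m a s := by
  unfold vertexSum
  rw [Finset.mul_sum]
  refine Finset.sum_congr rfl fun T _ => ?_
  have h (x : ℝ) : truncPow m (c * x) = c ^ m * truncPow m x := by
    unfold truncPow
    simp only [mul_nonneg_iff_of_pos_left hc, mul_pow]
    split_ifs <;> simp
  rw [← Finset.mul_sum, ← mul_sub, h]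
  ring

/-- Summing `truncPow_vertex_isLittleO` over the vertices: the terms linear in `u` cancel and the
quadratic ones add up to a multiple of `sqNorm u`. -/
theorem expansion_vertexSum (m : ℕ) (t : ℝ) :
    HasFirstOrderExpansion (tangentNhds (Fin (m + 4))) sqNorm
      (fun u => vertexSum (m + 3) (fun i => 1 + u i)
        ((m + 4 : ℝ) / 2 - t * √((m + 4 : ℝ) + sqNorm u)))
      (vertexSum (m + 3) (fun _ : Fin (m + 4) => 1) ((m + 4 : ℝ) / 2 - t * √(m + 4 : ℝ)))
      (∑ T : Finset (Fin (m + 4)), (-1 : ℝ) ^ T.card *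
        (truncPow (m + 1) ((m + 4 : ℝ) / 2 - t * √(m + 4 : ℝ) - T.card) *
          (-((m + 3) * ((m + 4 : ℝ) / 2 - t * √(m + 4 : ℝ) - T.card) * (t / (2 * √(m + 4 : ℝ))))
            + (m + 3) * (m + 2) / 2 * (T.card * (m + 4 - T.card)) / ((m + 4) * (m + 3))))) := by
  have hD : (0 : ℝ) < m + 4 := by positivity
  set z : ℝ := (m + 4 : ℝ) / 2 - t * √(m + 4 : ℝ) with hz
  have hsum := IsLittleO.sum (s := Finset.univ) fun (T : Finset (Fin (m + 4))) _ =>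
    (truncPow_vertex_isLittleO m hD t (z - T.card) T).const_mul_left ((-1 : ℝ) ^ T.card)
  refine hsum.congr' ?_ EventuallyEq.rfl
  filter_upwards [eventually_sum_eq_zero] with u hu
  have hlin := sum_weight_mul_sum_eq_zero
    (fun k => (-1 : ℝ) ^ k * ((m + 3) * truncPow (m + 2) (z - k))) hu
  have hquad := sum_weight_mul_sum_sq_eq
    (fun k => (-1 : ℝ) ^ k * ((m + 3) * (m + 2) / 2 * truncPow (m + 1) (z - k))) hu
  have hquad' : ∑ T : Finset (Fin (m + 4)), (-1 : ℝ) ^ T.card *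
      ((m + 3) * (m + 2) / 2 * truncPow (m + 1) (z - T.card)) * (∑ i ∈ T, u i) ^ 2
      = (∑ T : Finset (Fin (m + 4)), (-1 : ℝ) ^ T.card *
        ((m + 3) * (m + 2) / 2 * truncPow (m + 1) (z - T.card)) *
          (T.card * (m + 4 - T.card)) / ((m + 4) * (m + 3))) * sqNorm u := by
    have hcard : (Fintype.card (Fin (m + 4)) : ℝ) = m + 4 := by simp
    rw [hcard, show (m + 4 - 1 : ℝ) = m + 3 by ring] at hquad
    rw [← Finset.sum_div, div_mul_eq_mul_div, eq_div_iff (by positivity), ← hquad]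
    ring
  have hconst : vertexSum (m + 3) (fun _ : Fin (m + 4) => 1) z
      = ∑ T : Finset (Fin (m + 4)), (-1 : ℝ) ^ T.card * truncPow (m + 3) (z - T.card) := by
    simp [vertexSum]
  have hfun : vertexSum (m + 3) (fun i => 1 + u i) ((m + 4 : ℝ) / 2 - t * √((m + 4 : ℝ) + sqNorm u))
      = ∑ T : Finset (Fin (m + 4)), (-1 : ℝ) ^ T.card * truncPow (m + 3) (z - T.card +
        (-(∑ i ∈ T, u i) - t * (√((m + 4 : ℝ) + sqNorm u) - √(m + 4 : ℝ)))) := by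
    unfold vertexSum
    refine Finset.sum_congr rfl fun T _ => ?_
    congr 2
    rw [Finset.sum_add_distrib, Finset.sum_const, nsmul_eq_mul, mul_one, hz]
    ring
  have hcoeff : (∑ T : Finset (Fin (m + 4)), (-1 : ℝ) ^ T.card *
        (truncPow (m + 1) (z - T.card) *
          (-((m + 3) * (z - T.card) * (t / (2 * √(m + 4 : ℝ))))
            + (m + 3) * (m + 2) / 2 * (T.card * (m + 4 - T.card)) / ((m + 4) * (m + 3))))) *
          sqNorm u
      = (∑ T : Finset (Fin (m + 4)), (-1 : ℝ) ^ T.card *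
          ((m + 3) * truncPow (m + 2) (z - T.card) * (-(t / (2 * √(m + 4 : ℝ)) * sqNorm u)))) +
        ∑ T : Finset (Fin (m + 4)), (-1 : ℝ) ^ T.card *
          ((m + 3) * (m + 2) / 2 * truncPow (m + 1) (z - T.card)) * (∑ i ∈ T, u i) ^ 2 := by
    rw [hquad', Finset.sum_mul, Finset.sum_mul, ← Finset.sum_add_distrib]
    refine Finset.sum_congr rfl fun T _ => ?_
    rw [truncPow_succ_eq_mul (m + 1)]
    ring
  rw [hfun, hconst, hcoeff]
  rw [← sub_eq_zero]
  rw [← hlin, Finset.sum_apply, ← Finset.sum_add_distrib, ← Finset.sum_add_distrib,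
    ← Finset.sum_sub_distrib, ← Finset.sum_sub_distrib]
  refine Finset.sum_congr rfl fun T _ => ?_
  ring

/-- For `a` on the sphere with positive coordinates, written as `(1 + u) / ‖1 + u‖` with
`∑ i, u i = 0`, the volume of the section orthogonal to `a` is `normalizedVolume m t u / (m + 3)!`,
where the dimension is `m + 4`. -/
noncomputable def normalizedVolume (m : ℕ) (t : ℝ) (u : Fin (m + 4) → ℝ) : ℝ :=
  √((m + 4 : ℝ) + sqNorm u) * ((∏ i, (1 + u i))⁻¹ *
    vertexSum (m + 3) (fun i => 1 + u i) ((m + 4 : ℝ) / 2 - t * √((m + 4 : ℝ) + sqNorm u)))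

theorem expansion_normalizedVolume (m : ℕ) {t z : ℝ} (hz : z = (m + 4 : ℝ) / 2 - t * √(m + 4 : ℝ))
    (hz0 : 0 ≤ z) (hz1 : z < (m + 4 : ℕ)) :
    HasFirstOrderExpansion (tangentNhds (Fin (m + 4))) sqNorm (normalizedVolume m t)
      (normalizedVolume m t 0)
      (√(m + 4 : ℝ) * ((m + 3) * (m + 2)) / (2 * (m + 4)) * diagonalSum (m + 4) z) := by
  have hD : (0 : ℝ) < m + 4 := by positivity
  have hq := tendsto_sqNorm_tangentNhds (ι := Fin (m + 4))
  have h := (expansion_sqrt hD).mul (expansion_prod_inv.mul (expansion_vertexSum m t) hq) hq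
  refine h.congr_coeff ?_ ?_
  · simp [normalizedVolume, sqNorm]
  · rw [← hz, ← sum_truncPow_mul_quadP m hz0 hz1]
    have hconst : vertexSum (m + 3) (fun _ : Fin (m + 4) => 1) z
        = ∑ T : Finset (Fin (m + 4)), (-1 : ℝ) ^ T.card *
          (truncPow (m + 1) (z - T.card) * (z - T.card) ^ 2) := by
      simp only [vertexSum, Finset.sum_const, nsmul_eq_mul, mul_one]
      refine Finset.sum_congr rfl fun T _ => ?_
      rw [truncPow_succ_eq_mul, truncPow_succ_eq_mul]
      ring
    rw [hconst]
    simp only [one_mul]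
    rw [Finset.mul_sum, Finset.mul_sum, ← Finset.sum_add_distrib, Finset.mul_sum, Finset.mul_sum,
      ← Finset.sum_add_distrib]
    refine Finset.sum_congr rfl fun T _ => ?_
    -- The two sides agree vertex by vertex, once `t` is eliminated in favor of `z` and the
    -- dimension is written as `r²` with `r = √(m + 4)`.
    have hs : 0 < √(m + 4 : ℝ) := Real.sqrt_pos.2 hD
    have hs2 : √(m + 4 : ℝ) ^ 2 = m + 4 := Real.sq_sqrt hD.le
    have ht : t = ((m + 4 : ℝ) / 2 - z) / √(m + 4 : ℝ) := by
      rw [eq_div_iff hs.ne']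
      linarith
    rw [ht, quadP]
    set r := √(m + 4 : ℝ)
    have hm : (m : ℝ) = r ^ 2 - 4 := by linarith
    have h1 : r ^ 2 - 1 ≠ 0 := by rw [hs2]; have := Nat.cast_nonneg (α := ℝ) m; intro h; linarith
    have h2 : r ^ 2 - 2 ≠ 0 := by rw [hs2]; have := Nat.cast_nonneg (α := ℝ) m; intro h; linarith
    push_cast
    rw [hm]
    have e1 : r ^ 2 - 4 + 4 = r ^ 2 := by ring
    have e2 : r ^ 2 - 4 + 3 = r ^ 2 - 1 := by ring
    have e3 : r ^ 2 - 4 + 2 = r ^ 2 - 2 := by ring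
    rw [e1, e2, e3]
    field_simp
    ring

/-- The coordinates `u` of a direction `a` for which `a` is a multiple of `1 + u` and
`∑ i, u i = 0`. -/
noncomputable def tangentCoord {m : ℕ} (a : EuclideanSpace ℝ (Fin (m + 4))) : Fin (m + 4) → ℝ :=
  fun i => (m + 4 : ℝ) / (∑ j, a j) * a i - 1

theorem sum_tangentCoord {m : ℕ} {a : EuclideanSpace ℝ (Fin (m + 4))} (ha : ∑ i, a i ≠ 0) :
    ∑ i, tangentCoord a i = 0 := by
  simp only [tangentCoord]
  rw [Finset.sum_sub_distrib, ← Finset.mul_sum, div_mul_cancel₀ _ ha]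
  simp

theorem sectionVolume_eq_normalizedVolume {m : ℕ} (t : ℝ) {a : EuclideanSpace ℝ (Fin (m + 4))}
    (ha : ∀ i, 0 < a i) (hnorm : ‖a‖ = 1) :
    0 ≤ normalizedVolume m t (tangentCoord a) ∧ sectionVolume t a
      = ENNReal.ofReal (normalizedVolume m t (tangentCoord a) / (m + 3).factorial) := by
  have hσ : 0 < ∑ i, a i := Finset.sum_pos (fun i _ => ha i) Finset.univ_nonempty
  obtain ⟨h1, h2⟩ := sectionVolume_eq_vertexSum (Nat.succ_pos (m + 2)) t a ha hnorm
  set r : ℝ := (m + 4 : ℝ) / ∑ i, a i with hr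
  have hr0 : 0 < r := by positivity
  have hu (i : Fin (m + 4)) : 1 + tangentCoord a i = r * a i := by simp [tangentCoord, hr]
  have hsq : ∑ i, a i ^ 2 = 1 := by
    have := EuclideanSpace.norm_sq_eq a
    simpa [hnorm] using this.symm
  -- `r` is the Euclidean norm of `1 + u`, whose square is the dimension plus `|u|²`.
  have hsqrt : √((m + 4 : ℝ) + sqNorm (tangentCoord a)) = r := by
    rw [Real.sqrt_eq_iff_mul_self_eq_of_pos hr0]
    have hσr : r * ∑ i, a i = m + 4 := div_mul_cancel₀ _ hσ.ne'
    have : sqNorm (tangentCoord a) = ∑ i, (r ^ 2 * a i ^ 2 - 2 * (r * a i) + 1) := by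
      refine Finset.sum_congr rfl fun i _ => ?_
      rw [show tangentCoord a i = r * a i - 1 by linarith [hu i]]
      ring
    rw [this, Finset.sum_add_distrib, Finset.sum_sub_distrib, ← Finset.mul_sum, ← Finset.mul_sum,
      ← Finset.mul_sum, hσr, hsq]
    simp
    ring
  have hs : (m + 4 : ℝ) / 2 - t * r = r * ((∑ i, a i) / 2 - t) := by
    rw [hr]; field_simp
  have hnv : normalizedVolume m t (tangentCoord a)
      = vertexSum (m + 3) a ((∑ i, a i) / 2 - t) / ∏ i, a i := by
    rw [normalizedVolume, hsqrt, hs]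
    simp_rw [hu]
    rw [vertexSum_mul _ _ _ hr0, Finset.prod_mul_distrib, Finset.prod_const, Finset.card_univ,
      Fintype.card_fin]
    have : ∏ i, a i ≠ 0 := (Finset.prod_pos fun i _ => ha i).ne'
    field_simp
    ring
  rw [hnv]
  refine ⟨div_nonneg h1 (Finset.prod_nonneg fun i _ => (ha i).le), ?_⟩
  rw [h2, div_div, mul_comm (∏ i, a i)]

/-- The unit vector along the main diagonal. -/
noncomputable def diagonalDirection (d : ℕ) : EuclideanSpace ℝ (Fin d) :=
  WithLp.toLp 2 fun _ => 1 / √(d : ℝ)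

theorem sum_diagonalDirection_pos (m : ℕ) : 0 < ∑ i, diagonalDirection (m + 4) i :=
  Finset.sum_pos (fun i _ => by simp only [diagonalDirection]; positivity) Finset.univ_nonempty

theorem norm_diagonalDirection (m : ℕ) : ‖diagonalDirection (m + 4)‖ = 1 := by
  rw [EuclideanSpace.norm_eq]
  simp only [diagonalDirection, norm_div, norm_one, Real.norm_of_nonneg (Real.sqrt_nonneg _),
    div_pow, one_pow, Real.sq_sqrt (Nat.cast_nonneg (m + 4))]
  have : (m : ℝ) + 4 ≠ 0 := by positivity
  simp [this]

theorem tangentCoord_diagonalDirection (m : ℕ) : tangentCoord (diagonalDirection (m + 4)) = 0 := by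
  ext i
  have : 0 < √((m : ℝ) + 4) := Real.sqrt_pos.2 (by positivity)
  have : (0 : ℝ) < m + 4 := by positivity
  simp [tangentCoord, diagonalDirection]
  field_simp
  ring

/-- Near the diagonal direction the parameter `u` tends to `0` in the tangent space, the direction
has positive coordinates, and `u` vanishes only at the diagonal direction itself. -/
theorem tendsto_tangentCoord (m : ℕ) :
    Tendsto tangentCoord (𝓝[Metric.sphere 0 1 \ {diagonalDirection (m + 4)}]
      diagonalDirection (m + 4)) (tangentNhds (Fin (m + 4))) ∧
    ∀ᶠ a in 𝓝[Metric.sphere 0 1 \ {diagonalDirection (m + 4)}] diagonalDirection (m + 4),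
      ‖a‖ = 1 ∧ (∀ i, 0 < a i) ∧ 0 < sqNorm (tangentCoord a) := by
  set e := diagonalDirection (m + 4)
  have hσ : Continuous fun a : EuclideanSpace ℝ (Fin (m + 4)) => ∑ j, a j := by fun_prop
  have hpos : ∀ᶠ a in 𝓝[Metric.sphere 0 1 \ {e}] e, ∀ i, 0 < a i := by
    refine nhdsWithin_le_nhds ?_
    refine eventually_all.2 fun i => ?_
    have hc : Continuous fun a : EuclideanSpace ℝ (Fin (m + 4)) => a i := by fun_prop
    refine hc.continuousAt.eventually_const_lt ?_
    simp only [e, diagonalDirection]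
    positivity
  have hσpos (a : EuclideanSpace ℝ (Fin (m + 4))) (ha : ∀ i, 0 < a i) : 0 < ∑ i, a i :=
    Finset.sum_pos (fun i _ => ha i) Finset.univ_nonempty
  constructor
  · refine tendsto_nhdsWithin_iff.2 ⟨?_, ?_⟩
    · have hcont : ContinuousAt (tangentCoord (m := m)) e := by
        refine continuousAt_pi.2 fun i => ?_
        have hc : Continuous fun a : EuclideanSpace ℝ (Fin (m + 4)) => a i := by fun_prop
        exact ((continuousAt_const.div hσ.continuousAt (sum_diagonalDirection_pos m).ne').mul
          hc.continuousAt).sub continuousAt_const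
      have := hcont.tendsto
      rw [tangentCoord_diagonalDirection] at this
      exact this.mono_left nhdsWithin_le_nhds
    · filter_upwards [hpos] with a ha using sum_tangentCoord (hσpos a ha).ne'
  · filter_upwards [hpos, self_mem_nhdsWithin] with a ha hmem
    have hnorm : ‖a‖ = 1 := mem_sphere_zero_iff_norm.1 hmem.1
    refine ⟨hnorm, ha, (Finset.sum_nonneg fun i _ => sq_nonneg _).lt_of_ne fun h => hmem.2 ?_⟩
    have hu (i : Fin (m + 4)) : tangentCoord a i = 0 :=
      pow_eq_zero_iff two_ne_zero |>.1
        ((Finset.sum_eq_zero_iff_of_nonneg fun i _ => sq_nonneg _).1 h.symm i (Finset.mem_univ i))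
    have hσa := hσpos a ha
    have hconst (i : Fin (m + 4)) : a i = (∑ j, a j) / (m + 4) := by
      have := hu i
      simp only [tangentCoord] at this
      field_simp at this ⊢
      linarith
    obtain ⟨c, hcdef⟩ : ∃ c, c = (∑ j, a j) / (m + 4 : ℝ) := ⟨_, rfl⟩
    have hc : 0 < c := by rw [hcdef]; positivity
    simp only [← hcdef] at hconst
    have hsq : ∑ i, a i ^ 2 = 1 := by
      have := EuclideanSpace.norm_sq_eq a
      simpa [hnorm] using this.symm
    simp_rw [hconst] at hsq
    rw [Finset.sum_const, Finset.card_univ, Fintype.card_fin, nsmul_eq_mul] at hsq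
    rw [Set.mem_singleton_iff]
    ext i
    have hN : (0 : ℝ) < (m + 4 : ℕ) := by positivity
    rw [hconst i]
    simp only [e, diagonalDirection]
    rw [eq_div_iff (Real.sqrt_pos.2 hN).ne', ← sq_eq_sq₀ (by positivity) zero_le_one, mul_pow,
      Real.sq_sqrt hN.le]
    linarith

/-! ### Local extrema at the main diagonal -/

theorem isStrictLocalMaxOn_diagonalDirection (m : ℕ) {t z : ℝ}
    (hz : z = (m + 4 : ℝ) / 2 - t * √(m + 4 : ℝ)) (hz0 : 0 ≤ z) (hz1 : z < (m + 4 : ℕ))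
    (hS : diagonalSum (m + 4) z < 0) :
    IsStrictLocalMaxOn (sectionVolume t) (Metric.sphere 0 1) (diagonalDirection (m + 4)) := by
  obtain ⟨hlim, hev⟩ := tendsto_tangentCoord m
  have hexp := expansion_normalizedVolume m hz hz0 hz1
  have hexp' : HasFirstOrderExpansion _ (fun a => sqNorm (tangentCoord a))
      (fun a => normalizedVolume m t (tangentCoord a)) _ _ := IsLittleO.comp_tendsto hexp hlim
  have hfact : (0 : ℝ) < (m + 3).factorial := by positivity
  filter_upwards [hev, hexp'.eventually_lt (hev.mono fun a ha => ha.2.2)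
    (mul_neg_of_pos_of_neg (by positivity) hS)] with a ⟨hnorm, hpos, _⟩ hlt
  obtain ⟨h1, h2⟩ := sectionVolume_eq_normalizedVolume t hpos hnorm
  obtain ⟨-, h4⟩ := sectionVolume_eq_normalizedVolume t (a := diagonalDirection (m + 4))
    (fun i => by simp only [diagonalDirection]; positivity) (norm_diagonalDirection m)
  rw [tangentCoord_diagonalDirection] at h4
  rw [h2, h4, ENNReal.ofReal_lt_ofReal_iff (div_pos (h1.trans_lt hlt) hfact)]
  exact div_lt_div_of_pos_right hlt hfact

theorem isStrictLocalMinOn_diagonalDirection (m : ℕ) {t z : ℝ}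
    (hz : z = (m + 4 : ℝ) / 2 - t * √(m + 4 : ℝ)) (hz0 : 0 ≤ z) (hz1 : z < (m + 4 : ℕ))
    (hS : 0 < diagonalSum (m + 4) z) :
    IsStrictLocalMinOn (sectionVolume t) (Metric.sphere 0 1) (diagonalDirection (m + 4)) := by
  obtain ⟨hlim, hev⟩ := tendsto_tangentCoord m
  have hexp := expansion_normalizedVolume m hz hz0 hz1
  have hexp' : HasFirstOrderExpansion _ (fun a => sqNorm (tangentCoord a))
      (fun a => normalizedVolume m t (tangentCoord a)) _ _ := IsLittleO.comp_tendsto hexp hlim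
  have hfact : (0 : ℝ) < (m + 3).factorial := by positivity
  filter_upwards [hev, hexp'.eventually_gt (hev.mono fun a ha => ha.2.2)
    (mul_pos (by positivity) hS)] with a ⟨hnorm, hpos, _⟩ hlt
  obtain ⟨-, h2⟩ := sectionVolume_eq_normalizedVolume t hpos hnorm
  obtain ⟨h3, h4⟩ := sectionVolume_eq_normalizedVolume t (a := diagonalDirection (m + 4))
    (fun i => by simp only [diagonalDirection]; positivity) (norm_diagonalDirection m)
  rw [tangentCoord_diagonalDirection] at h3 h4
  rw [h2, h4, ENNReal.ofReal_lt_ofReal_iff (div_pos (h3.trans_lt hlt) hfact)]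
  exact div_lt_div_of_pos_right hlt hfact

/-! ### Reduction to the main diagonal -/

/-- The difference `δ` of two opposite vertices has coordinates `±1`. If it is orthogonal to all
differences of points of the hyperplane, it is a multiple of the unit normal `a`. -/
theorem sq_eq_of_isOrthogonalToDiagonal {d : ℕ} {t : ℝ} {a : EuclideanSpace ℝ (Fin d)}
    (hnorm : ‖a‖ = 1) (h : IsOrthogonalToDiagonal (hyperplaneAt t a)) (i : Fin d) :
    (d : ℝ) * a i ^ 2 = 1 := by
  obtain ⟨v, w, hv, hw, hvw⟩ := h
  set δ := w - v with hδ
  have hδsq (i : Fin d) : δ i ^ 2 = 1 := by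
    rw [hδ, PiLp.sub_apply, hw i]
    rcases hv i with h | h <;> rw [h] <;> norm_num
  have haa : ⟪a, a⟫_ℝ = 1 := by rw [real_inner_self_eq_norm_sq, hnorm, one_pow]
  set c := ⟪a, δ⟫_ℝ with hc
  set b := (∑ i, a i) / 2 - t with hb
  have hmem₀ : b • a ∈ hyperplaneAt t a := by
    rw [hyperplaneAt, Set.mem_ofPred_eq, real_inner_smul_right, haa, mul_one]
  have hmem₁ : b • a + (δ - c • a) ∈ hyperplaneAt t a := by
    rw [hyperplaneAt, Set.mem_ofPred_eq, inner_add_right, inner_sub_right, real_inner_smul_right,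
      real_inner_smul_right, haa, ← hc]
    ring
  have horth := hvw _ hmem₁ _ hmem₀
  rw [add_sub_cancel_left] at horth
  -- The component `δ - c • a` of `δ` orthogonal to `a` is a direction of the hyperplane.
  have hself : ⟪δ - c • a, δ - c • a⟫_ℝ = 0 := by
    rw [inner_sub_right, horth, real_inner_smul_right, inner_sub_left, real_inner_smul_left, haa,
      real_inner_comm, ← hc]
    ring
  have heq : δ = c • a := sub_eq_zero.1 (inner_self_eq_zero.1 hself)
  have hi (i : Fin d) : c ^ 2 * a i ^ 2 = 1 := by
    rw [← hδsq i, heq, PiLp.smul_apply, smul_eq_mul, mul_pow]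
  have hsq : ∑ i, a i ^ 2 = 1 := by
    have := EuclideanSpace.norm_sq_eq a
    simpa [hnorm] using this.symm
  have hcd : c ^ 2 = d := by
    have : ∑ i, c ^ 2 * a i ^ 2 = d := by simp [hi]
    rwa [← Finset.mul_sum, hsq, mul_one] at this
  rw [← hcd, hi i]

/-- Reflections of the cube reduce a general direction orthogonal to a diagonal to the direction
with equal positive coordinates. -/
theorem exists_tendsto_diagonalDirection {m : ℕ} {a : EuclideanSpace ℝ (Fin (m + 4))}
    (ha : ∀ i, ((m + 4 : ℕ) : ℝ) * a i ^ 2 = 1) (t : ℝ) :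
    ∃ f : EuclideanSpace ℝ (Fin (m + 4)) → EuclideanSpace ℝ (Fin (m + 4)),
      f a = diagonalDirection (m + 4) ∧ (∀ x, sectionVolume t (f x) = sectionVolume t x) ∧
      Tendsto f (𝓝[Metric.sphere 0 1 \ {a}] a)
        (𝓝[Metric.sphere 0 1 \ {diagonalDirection (m + 4)}] diagonalDirection (m + 4)) := by
  have hN : (0 : ℝ) < (m + 4 : ℕ) := by positivity
  have hs := Real.sqrt_pos.2 hN
  set ε : Fin (m + 4) → ℝ := fun i => √((m + 4 : ℕ) : ℝ) * a i with hεdef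
  have hε (i : Fin (m + 4)) : ε i ^ 2 = 1 := by
    simp only [hεdef]
    rw [mul_pow, Real.sq_sqrt hN.le, ha]
  let f : EuclideanSpace ℝ (Fin (m + 4)) → EuclideanSpace ℝ (Fin (m + 4)) :=
    fun x => WithLp.toLp 2 fun i => ε i * x i
  have hfa : f a = diagonalDirection (m + 4) := by
    ext i
    simp only [f, diagonalDirection, hεdef]
    rw [eq_div_iff hs.ne', ← ha i, ← Real.sq_sqrt hN.le, Real.sqrt_sq hs.le]
    ring
  have hff (x : EuclideanSpace ℝ (Fin (m + 4))) : f (f x) = x := by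
    ext i
    simp only [f]
    linear_combination x i * hε i
  have hfnorm (x : EuclideanSpace ℝ (Fin (m + 4))) : ‖f x‖ = ‖x‖ := by
    rw [EuclideanSpace.norm_eq, EuclideanSpace.norm_eq]
    congr 1
    refine Finset.sum_congr rfl fun i _ => ?_
    simp only [f, Real.norm_eq_abs, sq_abs, mul_pow, hε, one_mul]
  have hfc : Continuous f := by
    refine (PiLp.continuous_toLp 2 _).comp (continuous_pi fun i => ?_)
    fun_prop
  refine ⟨f, hfa, fun x => sectionVolume_mul_sign t x hε, ?_⟩
  rw [← hfa]
  refine tendsto_nhdsWithin_iff.2 ⟨hfc.continuousAt.mono_left nhdsWithin_le_nhds, ?_⟩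
  filter_upwards [self_mem_nhdsWithin] with x hx
  refine ⟨mem_sphere_zero_iff_norm.2 ((hfnorm x).trans (mem_sphere_zero_iff_norm.1 hx.1)), ?_⟩
  intro h
  apply hx.2
  rw [Set.mem_singleton_iff] at h ⊢
  rw [← hff x, h, hff]

theorem mainTheorem2 (d : ℕ) (hd : 4 ≤ d) (t : ℝ) (ht0 : 0 ≤ t) (ht1 : t < √(d : ℝ) / 2)
    (z : ℝ) (hz : z = (d : ℝ) / 2 - t * √(d : ℝ)) :
    (diagonalSum d z < 0 →
      ∀ a ∈ Metric.sphere (0 : EuclideanSpace ℝ (Fin d)) 1,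
        IsOrthogonalToDiagonal (hyperplaneAt t a) →
          IsStrictLocalMaxOn (sectionVolume t) (Metric.sphere 0 1) a) ∧
    (0 < diagonalSum d z →
      ∀ a ∈ Metric.sphere (0 : EuclideanSpace ℝ (Fin d)) 1,
        IsOrthogonalToDiagonal (hyperplaneAt t a) →
          IsStrictLocalMinOn (sectionVolume t) (Metric.sphere 0 1) a) := by
  obtain ⟨m, rfl⟩ : ∃ m, d = m + 4 := ⟨d - 4, by omega⟩
  have hs : 0 < √((m + 4 : ℕ) : ℝ) := Real.sqrt_pos.2 (by positivity)
  have hs2 : √((m + 4 : ℕ) : ℝ) ^ 2 = (m + 4 : ℕ) := Real.sq_sqrt (by positivity)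
  have hz0 : 0 ≤ z := by nlinarith
  have hz1 : z < (m + 4 : ℕ) := by nlinarith
  have hz' : z = (m + 4 : ℝ) / 2 - t * √(m + 4 : ℝ) := by simpa using hz
  refine ⟨fun hS a ha hdiag => ?_, fun hS a ha hdiag => ?_⟩
  · obtain ⟨f, hfa, hfV, hf⟩ := exists_tendsto_diagonalDirection
      (sq_eq_of_isOrthogonalToDiagonal (mem_sphere_zero_iff_norm.1 ha) hdiag) t
    refine (hf.eventually (isStrictLocalMaxOn_diagonalDirection m hz' hz0 hz1 hS)).mono
      fun x hx => ?_
    rwa [hfV, ← hfa, hfV] at hx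
  · obtain ⟨f, hfa, hfV, hf⟩ := exists_tendsto_diagonalDirection
      (sq_eq_of_isOrthogonalToDiagonal (mem_sphere_zero_iff_norm.1 ha) hdiag) t
    refine (hf.eventually (isStrictLocalMinOn_diagonalDirection m hz' hz0 hz1 hS)).mono
      fun x hx => ?_
    rwa [hfV, ← hfa, hfV] at hx
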